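/- Let $c>0$ and $\alpha>-\tfrac12$ be real numbers with $c^2>\alpha^2-\tfrac14$. Let $$\mathcal H_c^{\alpha}f(x)=\int_0^1\sqrt{ctx}\,J_\alpha(ctx)f(t)\,dt ,\qquad x\in[0,1],$$ be the finite Hankel transform on $L^2(0,1)$, where $J_\alpha$ is the Bessel function of the first kind of order $\alpha$, and let $$\mathcal D_c^{\alpha}\varphi(x)=\frac{d}{dx}\Big[(1-x^2)\varphi'(x)\Big]+\Big(\frac{\frac14-\alpha^2}{x^2}-c^2x^2\Big)\varphi(x).$$ The common eigenfunctions $\varphi_{n,c}^{(\alpha)}$, $n=0,1,2,\dots$, of $\mathcal H_c^\alpha$ (with nonzero eigenvalues) and of $-\mathcal D_c^\alpha$ on $(0,1)$, normalized by $\int_0^1(\varphi_{n,c}^{(\alpha)})^2=1$, are numbered so that the corresponding eigenvalues of $-\mathcal D_c^{\alpha}$, $-\mathcal D_c^{\alpha}\varphi_{n,c}^{(\alpha)}=\chi_{n,\alpha}(c)\,\varphi_{n,c}^{(\alpha)}$, satisfy $\chi_{0,\alpha}(c)<\chi_{1,\alpha}(c)<\cdots$. Then for every integer $n\ge 1$ with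 $$\chi_{n,\alpha}(c)\ge c^2+\alpha^2-\tfrac14\qquad\text{and}\qquad \frac{\sqrt{\chi_{n,\alpha}(c)}}{1-b_\alpha}\,b_\alpha^{3/2}\le 3\sqrt{\tfrac32},\qquad\text{where } b_\alpha=\frac{\pi+\frac{\pi}{2}\alpha-\frac34}{\sqrt{\chi_{n,\alpha}(c)-(\alpha^2-\frac14)}},$$ we have $$\sup_{x\in[0,1]}\big|\varphi_{n,c}^{(\alpha)}(x)\big|\le 3\sqrt{\tfrac32}\;\chi_{n,\alpha}(c)^{1/2}.$$ -/

import Mathlib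

open MeasureTheory Set

noncomputable section

/-- Bessel function of the first kind and order `α`, at a real argument `x ≥ 0`:
`J_α(x) = ∑_k (-1)^k / (k! Γ(k+α+1)) (x/2)^(2k+α)`. -/
def besselJ (α x : ℝ) : ℝ :=
  ∑' k : ℕ, (-1 : ℝ) ^ k / ((k.factorial : ℝ) * Real.Gamma ((k : ℝ) + α + 1)) *
    (x / 2) ^ (2 * (k : ℝ) + α)

/-- The finite Hankel transform
`(H_c^α f)(x) = ∫₀¹ √(c t x) J_α(c t x) f(t) dt`. -/
def finiteHankel (α c : ℝ) (f : ℝ → ℝ) (x : ℝ) : ℝ :=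
  ∫ t in (0 : ℝ)..1, Real.sqrt (c * t * x) * besselJ α (c * t * x) * f t

/-- The differential operator
`(D_c^α φ)(x) = ((1 - x²) φ'(x))' + ((1/4 - α²)/x² - c² x²) φ(x)`. -/
def hankelDiffOp (α c : ℝ) (φ : ℝ → ℝ) (x : ℝ) : ℝ :=
  deriv (fun y => (1 - y ^ 2) * deriv φ y) x +
    ((1 / 4 - α ^ 2) / x ^ 2 - c ^ 2 * x ^ 2) * φ x

/-- `φ` is a circular prolate spheroidal wave function on `[0,1]`, normalized in `L²(0,1)`,
and `χ` is the eigenvalue of `-D_c^α` that belongs to it. Membership in the range of the finite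
Hankel transform is what singles out the behaviour `x^(α+1/2)` at `0`; for `|α| ≤ 1/2` every
solution of the differential equation is bounded there. -/
structure IsCPSWF (α c χ : ℝ) (φ : ℝ → ℝ) : Prop where
  /-- `φ ∈ L²(0,1)` -/
  memLp : MemLp φ 2 (volume.restrict (Ioo (0 : ℝ) 1))
  /-- `‖φ‖ = 1` in `L²(0,1)` -/
  normalized : ∫ x in (0 : ℝ)..1, φ x ^ 2 = 1
  /-- `φ` is an eigenfunction of the finite Hankel transform (everywhere on `[0,1]`, so that the
  values of `φ` there are those of the continuous representative) -/
  hankel_eigen : ∃ μ : ℝ, μ ≠ 0 ∧ ∀ x ∈ Icc (0 : ℝ) 1, finiteHankel α c φ x = μ * φ x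
  /-- `φ` is twice continuously differentiable inside the interval -/
  contDiffOn : ContDiffOn ℝ 2 φ (Ioo (0 : ℝ) 1)
  /-- `-D_c^α φ = χ φ` -/
  diff_eigen : ∀ x ∈ Ioo (0 : ℝ) 1, -hankelDiffOp α c φ x = χ * φ x

/-- The set `{χ_{n,α}(c) : n ≥ 0}` of eigenvalues of `-D_c^α`. -/
def chiSpectrum (α c : ℝ) : Set ℝ := {χ | ∃ φ : ℝ → ℝ, IsCPSWF α c χ φ}

/-- `χ = χ_{n,α}(c)` and `φ = φ_{n,c}^{(α)}` (unique up to sign): the eigenvalues are numbered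
from `0` in increasing order, so exactly `n` of them lie below the `n`-th one. -/
structure IsNthCPSWF (α c : ℝ) (n : ℕ) (χ : ℝ) (φ : ℝ → ℝ) : Prop where
  isCPSWF : IsCPSWF α c χ φ
  rank : {χ' | χ' ∈ chiSpectrum α c ∧ χ' < χ}.encard = n

/-- `b_α = (π + (π/2) α - 3/4) / √(χ - (α² - 1/4))`. -/
def bAlpha (α χ : ℝ) : ℝ :=
  (Real.pi + Real.pi / 2 * α - 3 / 4) / Real.sqrt (χ - (α ^ 2 - 1 / 4))

end

/-!
Write `s = α + 1/2 > 0`. The bound comes from an energy estimate in the interior of `[0,1]`, and from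
the differential equation near the end points.

Expanding the Bessel function under the integral shows that an eigenfunction of the finite Hankel
transform is `φ = x^s v` with `v` entire (`IsCPSWF.exists_isRegularProfile`). In terms of `v` the
differential equation reads `((1 - x²) x^(2s) v')' = -(lam - c² x²) x^(2s) v`, where
`lam = χ - s² - s`, and the flux `(1 - x²) x^(2s) v'` vanishes at both end points. Hence
`∫ (1 - x²) x^(2s) v'² ≤ lam` (`IsRegularProfile.energy_le`); in particular `s² + s ≤ χ`.

Three pointwise facts follow. Integrating `(x φ²)'` and using the energy gives `φ² ≤ 25/3 χ` for
`1 / (2 √χ) ≤ x ≤ 1 - 1 / (5 χ)` (`IsRegularProfile.sq_le_of_mem_middle`). On the remaining interval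
at `0` the function `v`, and on the one at `1` the function `φ`, varies by at most a fifth of its
maximum there (`IsRegularProfile.abs_sub_le_left`, `IsRegularProfile.abs_sub_le_right`). So the
maximum `M` of `|φ|` satisfies `4/5 M ≤ √(25/3 χ)`, which is stronger than the claim
(`IsRegularProfile.sq_le_mul_eigenvalue`).

The constants need `χ ≥ 3/2`. If `s ≥ 1`, this is part of `s² + s ≤ χ`. If `s < 1`, it is a statement
about all eigenvalues but the lowest (for the lowest one the bound on `φ` itself can fail): two
eigenfunctions with different eigenvalues are orthogonal, so by the min-max principle the larger
eigenvalue is bounded below by the constant of a Poincaré inequality for functions that vanish at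
`1/√2` (`IsRegularProfile.three_halves_le_of_lt`).
-/

/-! ### Regular profiles -/

/-- The function `v`, with derivative `dv`, is a regular normalized profile with eigenvalue `lam`:
`((1 - x²) x^(2s) v')' = -(lam - c² x²) x^(2s) v` on `(0,1)`, `v` is continuously differentiable up
to the end points and beyond (so that the flux `(1 - x²) x^(2s) v'` vanishes at `0` and `1`), and
`∫₀¹ (x^s v)² = 1`. For `s = α + 1/2`, the function `x^s v` is then an eigenfunction of `-D_c^α`
with eigenvalue `lam + s² + s`. -/
structure IsRegularProfile (s c lam : ℝ) (v dv : ℝ → ℝ) : Prop where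
  hasDerivAt : ∀ x, HasDerivAt v (dv x) x
  continuous_deriv : Continuous dv
  ode : ∀ x ∈ Ioo (0 : ℝ) 1, HasDerivAt (fun y => (1 - y ^ 2) * y ^ (2 * s) * dv y)
    (-((lam - c ^ 2 * x ^ 2) * x ^ (2 * s) * v x)) x
  normalized : ∫ x in (0 : ℝ)..1, x ^ (2 * s) * v x ^ 2 = 1

theorem integral_eq_sub_of_continuousOn {f f' : ℝ → ℝ} {a b : ℝ} (hab : a ≤ b)
    (hf : ContinuousOn f (Icc a b)) (hf' : ContinuousOn f' (Icc a b))
    (hd : ∀ x ∈ Ioo a b, HasDerivAt f (f' x) x) : ∫ x in a..b, f' x = f b - f a :=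
  intervalIntegral.integral_eq_sub_of_hasDerivAt_of_le hab hf hd
    (hf'.intervalIntegrable_of_Icc hab)

theorem continuous_rpow_two_mul {s : ℝ} (hs : 0 < s) : Continuous fun x : ℝ => x ^ (2 * s) :=
  Real.continuous_rpow_const (by linarith)

theorem hasDerivAt_rpow_two_mul_add_one {s x : ℝ} (hx : 0 < x) :
    HasDerivAt (fun y : ℝ => y * y ^ (2 * s)) ((2 * s + 1) * x ^ (2 * s)) x := by
  have h := (hasDerivAt_id x).mul (Real.hasDerivAt_rpow_const (p := 2 * s) (Or.inl hx.ne'))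
  refine h.congr_deriv ?_
  rw [Real.rpow_sub_one hx.ne']
  simp only [id]
  field_simp
  ring

namespace IsRegularProfile

variable {s c lam lam₁ lam₂ : ℝ} {v dv v₁ dv₁ v₂ dv₂ : ℝ → ℝ}

theorem continuous (h : IsRegularProfile s c lam v dv) : Continuous v :=
  continuous_iff_continuousAt.2 fun x => (h.hasDerivAt x).continuousAt

/-- The weak form of the equation. The boundary terms vanish because of the weights
`1 - x ^ 2` and `x ^ (2 * s)`, whatever the sign of `s - 1 / 2`. -/
theorem integral_deriv_mul_deriv (hs : 0 < s) (h₁ : IsRegularProfile s c lam₁ v₁ dv₁)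
    (h₂ : IsRegularProfile s c lam₂ v₂ dv₂) :
    ∫ x in (0 : ℝ)..1, (1 - x ^ 2) * x ^ (2 * s) * (dv₁ x * dv₂ x) =
      lam₁ * (∫ x in (0 : ℝ)..1, x ^ (2 * s) * (v₁ x * v₂ x)) -
        c ^ 2 * ∫ x in (0 : ℝ)..1, x ^ 2 * x ^ (2 * s) * (v₁ x * v₂ x) := by
  have hr := continuous_rpow_two_mul hs
  have c₁ := h₁.continuous
  have c₂ := h₂.continuous
  have d₁ := h₁.continuous_deriv
  have d₂ := h₂.continuous_deriv
  have key := integral_eq_sub_of_continuousOn (a := 0) (b := 1)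
    (f := fun x => (1 - x ^ 2) * x ^ (2 * s) * dv₁ x * v₂ x)
    (f' := fun x => -((lam₁ - c ^ 2 * x ^ 2) * x ^ (2 * s) * v₁ x) * v₂ x
      + (1 - x ^ 2) * x ^ (2 * s) * dv₁ x * dv₂ x) zero_le_one
    (by fun_prop) (by fun_prop) (fun x hx => (h₁.ode x hx).mul (h₂.hasDerivAt x))
  have h0 : (0 : ℝ) ^ (2 * s) = 0 := Real.zero_rpow (by linarith)
  simp only [h0] at key
  have e : ∀ x : ℝ, -((lam₁ - c ^ 2 * x ^ 2) * x ^ (2 * s) * v₁ x) * v₂ x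
      + (1 - x ^ 2) * x ^ (2 * s) * dv₁ x * dv₂ x =
      (1 - x ^ 2) * x ^ (2 * s) * (dv₁ x * dv₂ x) - (lam₁ * (x ^ (2 * s) * (v₁ x * v₂ x)) -
        c ^ 2 * (x ^ 2 * x ^ (2 * s) * (v₁ x * v₂ x))) := fun x => by ring
  simp only [e] at key
  rw [intervalIntegral.integral_sub, intervalIntegral.integral_sub,
    intervalIntegral.integral_const_mul, intervalIntegral.integral_const_mul] at key
  · linarith
  all_goals exact Continuous.intervalIntegrable (by fun_prop) _ _

theorem orthogonal (hs : 0 < s) (h₁ : IsRegularProfile s c lam₁ v₁ dv₁)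
    (h₂ : IsRegularProfile s c lam₂ v₂ dv₂) (hne : lam₁ ≠ lam₂) :
    ∫ x in (0 : ℝ)..1, x ^ (2 * s) * (v₁ x * v₂ x) = 0 := by
  have e₁ := integral_deriv_mul_deriv hs h₁ h₂
  have e₂ := integral_deriv_mul_deriv hs h₂ h₁
  simp only [mul_comm (dv₂ _), mul_comm (v₂ _)] at e₂
  have : (lam₁ - lam₂) * (∫ x in (0 : ℝ)..1, x ^ (2 * s) * (v₁ x * v₂ x)) = 0 := by linarith
  exact (mul_eq_zero.1 this).resolve_left (sub_ne_zero.2 hne)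

theorem energy_le (hs : 0 < s) (h : IsRegularProfile s c lam v dv) :
    ∫ x in (0 : ℝ)..1, (1 - x ^ 2) * x ^ (2 * s) * dv x ^ 2 ≤ lam := by
  have e := integral_deriv_mul_deriv hs h h
  simp only [← sq] at e
  rw [h.normalized] at e
  have : 0 ≤ ∫ x in (0 : ℝ)..1, x ^ 2 * x ^ (2 * s) * v x ^ 2 :=
    intervalIntegral.integral_nonneg zero_le_one fun x hx => by
      have := Real.rpow_nonneg hx.1 (2 * s)
      positivity
  nlinarith [mul_nonneg (sq_nonneg c) this]

theorem eigenvalue_nonneg (hs : 0 < s) (h : IsRegularProfile s c lam v dv) : 0 ≤ lam :=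
  le_trans (intervalIntegral.integral_nonneg zero_le_one fun x hx => by
    have := Real.rpow_nonneg hx.1 (2 * s)
    have : 0 ≤ 1 - x ^ 2 := by nlinarith [hx.1, hx.2]
    positivity) (h.energy_le hs)

end IsRegularProfile

/-! ### A Poincaré inequality for functions vanishing at `1/√2` -/

/-- Completing the square with `u = 1 - 3/2 x²`, for which
`-(x^(2s) u')' = 3 (2s+1) x^(2s) ≥ 3 x^(2s) u`; the weight `1 - x²` is bounded below by `1/2`. -/
theorem weighted_poincare_left {s z : ℝ} {h dh : ℝ → ℝ} (hs : 0 < s) (hz : 0 < z)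
    (hz2 : z ^ 2 = 1 / 2) (hd : ∀ x, HasDerivAt h (dh x) x) (hc : Continuous dh)
    (h0 : h z = 0) :
    3 / 2 * ∫ x in (0 : ℝ)..z, x ^ (2 * s) * h x ^ 2 ≤
      ∫ x in (0 : ℝ)..z, (1 - x ^ 2) * x ^ (2 * s) * dh x ^ 2 := by
  have hr := continuous_rpow_two_mul hs
  have ch : Continuous h := continuous_iff_continuousAt.2 fun x => (hd x).continuousAt
  have hu : ∀ x ∈ Icc (0 : ℝ) z, 0 < 1 - 3 / 2 * x ^ 2 := fun x hx => by
    nlinarith [hx.1, hx.2]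
  have cu : ContinuousOn (fun x : ℝ => (1 - 3 / 2 * x ^ 2)⁻¹) (Icc 0 z) :=
    ContinuousOn.inv₀ (by fun_prop) fun x hx => (hu x hx).ne'
  set F' : ℝ → ℝ := fun x => ((2 * s + 1) * x ^ (2 * s) * h x ^ 2 +
      x * x ^ (2 * s) * (2 * h x * dh x)) * (1 - 3 / 2 * x ^ 2)⁻¹ +
      x * x ^ (2 * s) * h x ^ 2 * (3 * x * ((1 - 3 / 2 * x ^ 2)⁻¹) ^ 2) with hF'
  have cF' : ContinuousOn F' (Icc 0 z) := by fun_prop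
  have key := integral_eq_sub_of_continuousOn (a := 0) (b := z)
    (f := fun x => x * x ^ (2 * s) * h x ^ 2 * (1 - 3 / 2 * x ^ 2)⁻¹) (f' := F') hz.le
    (by fun_prop) cF' (fun x hx => by
      have h1 := hasDerivAt_rpow_two_mul_add_one (s := s) hx.1
      have h2 := (hd x).pow 2
      have h3 : HasDerivAt (fun x : ℝ => 1 - 3 / 2 * x ^ 2) (- (3 * x)) x := by
        refine (((hasDerivAt_pow 2 x).const_mul (3 / 2 : ℝ)).const_sub 1).congr_deriv ?_
        push_cast
        ring
      have h4 := h3.inv (hu x ⟨hx.1.le, hx.2.le⟩).ne'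
      refine ((h1.mul h2).mul h4).congr_deriv ?_
      simp only [hF', Pi.mul_apply, Pi.pow_apply, Pi.inv_apply]
      push_cast
      field_simp)
  simp only [h0] at key
  have key' : ∫ x in (0 : ℝ)..z, F' x = 0 := by rw [key]; simp
  rw [← intervalIntegral.integral_const_mul]
  have step : ∫ x in (0 : ℝ)..z, 3 / 2 * (x ^ (2 * s) * h x ^ 2) ≤
      ∫ x in (0 : ℝ)..z, ((1 - x ^ 2) * x ^ (2 * s) * dh x ^ 2 + 3 / 2 * F' x) := by
    apply intervalIntegral.integral_mono_on hz.le
      (Continuous.intervalIntegrable (by fun_prop) _ _)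
      (ContinuousOn.intervalIntegrable_of_Icc hz.le (by fun_prop))
    intro x hx
    have hux := hu x hx
    have hrx := Real.rpow_nonneg hx.1 (2 * s)
    have hx2 : x ^ 2 ≤ 1 / 2 := by nlinarith [hx.1, hx.2]
    set q := (1 - 3 / 2 * x ^ 2)⁻¹ with hq
    have q1 : 1 ≤ q := (one_le_inv₀ hux).2 (by nlinarith)
    have e : (1 - x ^ 2) * x ^ (2 * s) * dh x ^ 2 + 3 / 2 * F' x - 3 / 2 * (x ^ (2 * s) * h x ^ 2)
      = x ^ (2 * s) * ((1 / 2 - x ^ 2) * dh x ^ 2 + 1 / 2 * (dh x + 3 * x * h x * q) ^ 2 +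
        3 / 2 * h x ^ 2 * ((2 * s) * q + (q - 1))) := by
      simp only [hF']
      ring
    have : 0 ≤ (1 / 2 - x ^ 2) * dh x ^ 2 + 1 / 2 * (dh x + 3 * x * h x * q) ^ 2 +
        3 / 2 * h x ^ 2 * ((2 * s) * q + (q - 1)) := by
      have a1 : 0 ≤ (1 / 2 - x ^ 2) * dh x ^ 2 := mul_nonneg (by linarith) (sq_nonneg _)
      have a2 : 0 ≤ (2 * s) * q + (q - 1) := by nlinarith
      positivity
    nlinarith [mul_nonneg hrx this]
  rw [intervalIntegral.integral_add, intervalIntegral.integral_const_mul (3 / 2) F', key'] at step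
  · linarith
  · exact Continuous.intervalIntegrable (by fun_prop) _ _
  · exact ContinuousOn.intervalIntegrable_of_Icc hz.le (by fun_prop)

/-- Completing the square with `u = x^(1-s)`, that is, comparing `x^s h` with the function `x`,
which solves `-((1 - x²) y')' = 2 y`. -/
theorem weighted_poincare_right {s z : ℝ} {h dh : ℝ → ℝ} (hs : 0 < s) (hs1 : s < 1) (hz : 0 < z)
    (hz2 : z ^ 2 = 1 / 2) (hd : ∀ x, HasDerivAt h (dh x) x) (hc : Continuous dh)
    (h0 : h z = 0) :
    (3 / 2 - s ^ 2 - s) * ∫ x in z..1, x ^ (2 * s) * h x ^ 2 ≤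
      ∫ x in z..1, (1 - x ^ 2) * x ^ (2 * s) * dh x ^ 2 := by
  have hz1 : z ≤ 1 := by nlinarith
  have hr := continuous_rpow_two_mul hs
  have ch : Continuous h := continuous_iff_continuousAt.2 fun x => (hd x).continuousAt
  have ci : ContinuousOn (fun x : ℝ => x⁻¹) (Icc z 1) :=
    ContinuousOn.inv₀ (by fun_prop) fun x hx => (hz.trans_le hx.1).ne'
  set F' : ℝ → ℝ := fun x => (1 - s) * (((2 * s - 1) * (1 - x ^ 2) * (x⁻¹) ^ 2 - 2) * h x ^ 2 +
    2 * (1 - x ^ 2) * x⁻¹ * h x * dh x) * x ^ (2 * s) with hF'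
  have cF' : ContinuousOn F' (Icc z 1) := by fun_prop
  have key := integral_eq_sub_of_continuousOn (a := z) (b := 1)
    (f := fun x => (1 - s) * (1 - x ^ 2) * (x ^ (2 * s) * x⁻¹) * h x ^ 2) (f' := F') hz1
    (by fun_prop) cF' (fun x hx => by
      have hx0 : 0 < x := hz.trans hx.1
      have h1 := (Real.hasDerivAt_rpow_const (x := x) (p := 2 * s) (Or.inl hx0.ne')).mul
        (hasDerivAt_inv hx0.ne')
      have h2 := (hd x).pow 2
      have h3 : HasDerivAt (fun x : ℝ => (1 - s) * (1 - x ^ 2)) ((1 - s) * (- (2 * x))) x := by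
        refine (((hasDerivAt_pow 2 x).const_sub 1).const_mul (1 - s)).congr_deriv ?_
        push_cast
        ring
      refine ((h3.mul h1).mul h2).congr_deriv ?_
      simp only [hF', Pi.mul_apply, Pi.pow_apply]
      rw [Real.rpow_sub_one hx0.ne']
      push_cast
      field_simp
      ring)
  simp only [h0] at key
  have key' : ∫ x in z..1, F' x = 0 := by rw [key]; simp
  rw [← intervalIntegral.integral_const_mul]
  have step : ∫ x in z..1, (3 / 2 - s ^ 2 - s) * (x ^ (2 * s) * h x ^ 2) ≤
      ∫ x in z..1, ((1 - x ^ 2) * x ^ (2 * s) * dh x ^ 2 - F' x) := by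
    apply intervalIntegral.integral_mono_on hz1
      (Continuous.intervalIntegrable (by fun_prop) _ _)
      (ContinuousOn.intervalIntegrable_of_Icc hz1 (by fun_prop))
    intro x hx
    have hx0 : 0 < x := hz.trans_le hx.1
    have hrx := Real.rpow_nonneg hx0.le (2 * s)
    have hx2 : x ^ 2 ≤ 1 := by nlinarith [hx.2]
    have hx3 : 1 / 2 ≤ x ^ 2 := by nlinarith [hx.1]
    have q2 : (x⁻¹) ^ 2 ≤ 2 := by
      rw [inv_pow, inv_le_comm₀ (by positivity) (by norm_num)]
      linarith
    have qx : x ^ 2 * (x⁻¹) ^ 2 = 1 := by field_simp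
    have e : (1 - x ^ 2) * x ^ (2 * s) * dh x ^ 2 - F' x
        - (3 / 2 - s ^ 2 - s) * (x ^ (2 * s) * h x ^ 2)
      = x ^ (2 * s) * ((1 - x ^ 2) * (dh x - (1 - s) * h x * x⁻¹) ^ 2 +
        h x ^ 2 * ((1 - s) * (2 + s - s * (x⁻¹) ^ 2) - (3 / 2 - s ^ 2 - s))) := by
      have : F' x = (1 - s) * (((2 * s - 1) * ((x⁻¹) ^ 2 - x ^ 2 * (x⁻¹) ^ 2) - 2) * h x ^ 2 +
        2 * (1 - x ^ 2) * x⁻¹ * h x * dh x) * x ^ (2 * s) := by simp only [hF']; ring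
      rw [this]
      linear_combination ((1 - s) * s * h x ^ 2 * x ^ (2 * s)) * qx
    have : 0 ≤ (1 - x ^ 2) * (dh x - (1 - s) * h x * x⁻¹) ^ 2 +
        h x ^ 2 * ((1 - s) * (2 + s - s * (x⁻¹) ^ 2) - (3 / 2 - s ^ 2 - s)) := by
      have a1 : 0 ≤ 1 - x ^ 2 := by linarith
      have a2 : 0 ≤ (1 - s) * (2 + s - s * (x⁻¹) ^ 2) - (3 / 2 - s ^ 2 - s) := by
        have : 0 ≤ (1 - s) * s * (2 - (x⁻¹) ^ 2) :=
          mul_nonneg (mul_nonneg (by linarith) hs.le) (by linarith)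
        nlinarith [sq_nonneg (2 * s - 1)]
      positivity
    nlinarith [mul_nonneg hrx this]
  rw [intervalIntegral.integral_sub, key'] at step
  · linarith
  · exact Continuous.intervalIntegrable (by fun_prop) _ _
  · exact ContinuousOn.intervalIntegrable_of_Icc hz1 (by fun_prop)

theorem weighted_poincare {s z : ℝ} {h dh : ℝ → ℝ} (hs : 0 < s) (hs1 : s < 1) (hz : 0 < z)
    (hz2 : z ^ 2 = 1 / 2) (hd : ∀ x, HasDerivAt h (dh x) x) (hc : Continuous dh)
    (h0 : h z = 0) :
    (3 / 2 - s ^ 2 - s) * ∫ x in (0 : ℝ)..1, x ^ (2 * s) * h x ^ 2 ≤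
      ∫ x in (0 : ℝ)..1, (1 - x ^ 2) * x ^ (2 * s) * dh x ^ 2 := by
  have hr := continuous_rpow_two_mul hs
  have ch : Continuous h := continuous_iff_continuousAt.2 fun x => (hd x).continuousAt
  have l := weighted_poincare_left hs hz hz2 hd hc h0
  have r := weighted_poincare_right hs hs1 hz hz2 hd hc h0
  have n : 0 ≤ ∫ x in (0 : ℝ)..z, x ^ (2 * s) * h x ^ 2 :=
    intervalIntegral.integral_nonneg hz.le fun x hx => by
      have := Real.rpow_nonneg hx.1 (2 * s)
      positivity
  rw [← intervalIntegral.integral_add_adjacent_intervals (b := z),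
    ← intervalIntegral.integral_add_adjacent_intervals (a := 0) (b := z) (c := 1)
      (f := fun x => (1 - x ^ 2) * x ^ (2 * s) * dh x ^ 2)]
  · nlinarith [mul_nonneg hs.le n, mul_nonneg (sq_nonneg s) n]
  all_goals exact Continuous.intervalIntegrable (by fun_prop) _ _

namespace IsRegularProfile

variable {s c lam lam₁ lam₂ : ℝ} {v dv v₁ dv₁ v₂ dv₂ : ℝ → ℝ}

/-! ### A lower bound for all eigenvalues but the lowest -/

/-- The min-max principle for the second eigenvalue: some nonzero combination of the two profiles
vanishes at `1/√2`; its energy is at most `lam₁` times its squared norm, and `weighted_poincare`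
bounds the energy from below. -/
theorem three_halves_le_of_lt (hs : 0 < s) (hs1 : s < 1) (h₁ : IsRegularProfile s c lam₁ v₁ dv₁)
    (h₂ : IsRegularProfile s c lam₂ v₂ dv₂) (hlt : lam₂ < lam₁) :
    3 / 2 - s ^ 2 - s ≤ lam₁ := by
  have hr := continuous_rpow_two_mul hs
  have c₁ := h₁.continuous
  have c₂ := h₂.continuous
  have d₁ := h₁.continuous_deriv
  have d₂ := h₂.continuous_deriv
  obtain ⟨z, hz, hz2⟩ : ∃ z : ℝ, 0 < z ∧ z ^ 2 = 1 / 2 :=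
    ⟨√(1 / 2), by positivity, Real.sq_sqrt (by norm_num)⟩
  by_cases hv : v₁ z = 0
  · have := weighted_poincare hs hs1 hz hz2 h₁.hasDerivAt d₁ hv
    rw [h₁.normalized, mul_one] at this
    exact this.trans (h₁.energy_le hs)
  set A := v₂ z
  set B := v₁ z
  have p := weighted_poincare (h := fun x => A * v₁ x - B * v₂ x)
    (dh := fun x => A * dv₁ x - B * dv₂ x) hs hs1 hz hz2
    (fun x => ((h₁.hasDerivAt x).const_mul A).sub ((h₂.hasDerivAt x).const_mul B))
    (by fun_prop) (by simp only [A, B]; ring)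
  have o := orthogonal hs h₁ h₂ hlt.ne'
  have e₁ := integral_deriv_mul_deriv hs h₁ h₁
  have e₂ := integral_deriv_mul_deriv hs h₂ h₂
  have e₁₂ := integral_deriv_mul_deriv hs h₁ h₂
  have n₁ := h₁.normalized
  have n₂ := h₂.normalized
  simp only [← sq] at e₁ e₂
  rw [n₁] at e₁
  rw [n₂] at e₂
  rw [o] at e₁₂
  have expand : ∀ (r f g : ℝ → ℝ), Continuous r → Continuous f → Continuous g →
      ∫ x in (0 : ℝ)..1, r x * (A * f x - B * g x) ^ 2 =
      A ^ 2 * (∫ x in (0 : ℝ)..1, r x * f x ^ 2) -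
        2 * A * B * (∫ x in (0 : ℝ)..1, r x * (f x * g x)) +
        B ^ 2 * (∫ x in (0 : ℝ)..1, r x * g x ^ 2) := by
    intro r f g hr hf hg
    rw [← intervalIntegral.integral_const_mul, ← intervalIntegral.integral_const_mul,
      ← intervalIntegral.integral_const_mul, ← intervalIntegral.integral_sub,
      ← intervalIntegral.integral_add]
    · congr 1
      ext x
      ring
    all_goals exact Continuous.intervalIntegrable (by fun_prop) _ _
  rw [expand _ _ _ hr c₁ c₂, expand _ _ _ (by fun_prop) d₁ d₂, n₁, n₂, o, e₁, e₂, e₁₂] at p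
  have q : 0 ≤ ∫ x in (0 : ℝ)..1, x ^ 2 * x ^ (2 * s) * (A * v₁ x - B * v₂ x) ^ 2 :=
    intervalIntegral.integral_nonneg zero_le_one fun x hx => by
      have := Real.rpow_nonneg hx.1 (2 * s)
      positivity
  rw [expand _ _ _ (by fun_prop) c₁ c₂] at q
  have hB : 0 < A ^ 2 + B ^ 2 := by positivity
  have q' := mul_nonneg (sq_nonneg c) q
  refine le_of_mul_le_mul_right ?_ hB
  nlinarith [mul_nonneg (sq_nonneg B) (sub_nonneg.2 hlt.le)]

/-! ### Pointwise estimates for a profile -/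

/-- Integrate `(t (t^s v)²)' = (2s+1) t^(2s) v² + 2 t^(2s+1) v v'` over `(0, x)` and bound the last
term by the norm and the energy of `v`. -/
theorem rpow_mul_sq_le_interior (hs : 0 < s) (h : IsRegularProfile s c lam v dv) {k x : ℝ}
    (hk : 0 < k) (hlam : lam ≤ k ^ 2) (hx : 0 < x) (hx' : 9 / (25 * k ^ 2) ≤ 1 - x ^ 2) :
    x ^ (2 * s) * v x ^ 2 ≤ (2 * s + 1) / x + 10 / 3 * k ^ 2 := by
  have hr := continuous_rpow_two_mul hs
  have cv := h.continuous
  have cd := h.continuous_deriv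
  have hp : 0 < 1 - x ^ 2 := lt_of_lt_of_le (by positivity) hx'
  have hx1 : x < 1 := by nlinarith
  have key := integral_eq_sub_of_continuousOn (a := 0) (b := x)
    (f := fun x => x * x ^ (2 * s) * v x ^ 2)
    (f' := fun x => (2 * s + 1) * x ^ (2 * s) * v x ^ 2 + x * x ^ (2 * s) * (2 * v x * dv x)) hx.le
    (by fun_prop) (by fun_prop) (fun t ht => by
      refine ((hasDerivAt_rpow_two_mul_add_one (s := s) ht.1).mul
        ((h.hasDerivAt t).pow 2)).congr_deriv ?_
      simp)
  have mono : ∀ f : ℝ → ℝ, Continuous f → (∀ t ∈ Icc (0 : ℝ) 1, 0 ≤ f t) →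
      ∫ t in (0 : ℝ)..x, f t ≤ ∫ t in (0 : ℝ)..1, f t := by
    intro f hf hf0
    refine intervalIntegral.integral_mono_interval le_rfl hx.le hx1.le ?_
      (hf.intervalIntegrable _ _)
    filter_upwards [ae_restrict_mem measurableSet_Ioc] with t ht using hf0 t ⟨ht.1.le, ht.2⟩
  -- The weight in `2ab ≤ r a² + b² / r` that makes both contributions at most `r`.
  set r := 5 / 3 * k ^ 2 * x with hrdef
  have hr0 : 0 < r := by positivity
  set T := x ^ 2 / (1 - x ^ 2) / r with hT
  have hT0 : 0 ≤ T := by positivity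
  have step : ∫ t in (0 : ℝ)..x, ((2 * s + 1) * t ^ (2 * s) * v t ^ 2
        + t * t ^ (2 * s) * (2 * v t * dv t)) ≤
      ∫ t in (0 : ℝ)..x, ((2 * s + 1 + r) * (t ^ (2 * s) * v t ^ 2) +
        T * ((1 - t ^ 2) * t ^ (2 * s) * dv t ^ 2)) := by
    apply intervalIntegral.integral_mono_on hx.le
      (Continuous.intervalIntegrable (by fun_prop) _ _)
      (Continuous.intervalIntegrable (by fun_prop) _ _)
    intro t ht
    have hrt := Real.rpow_nonneg ht.1 (2 * s)
    have ht2 : t ^ 2 ≤ x ^ 2 := by nlinarith [ht.1, ht.2]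
    have a1 : t ^ 2 / r ≤ T * (1 - t ^ 2) := by
      rw [hT, div_right_comm, div_mul_eq_mul_div, div_mul_eq_mul_div,
        le_div_iff₀ hp, div_mul_eq_mul_div]
      gcongr
    have a2 : t * (2 * v t * dv t) ≤ r * v t ^ 2 + t ^ 2 / r * dv t ^ 2 := by
      have : 0 ≤ (r * v t - t * dv t) ^ 2 / r := by positivity
      have e : (r * v t - t * dv t) ^ 2 / r =
        r * v t ^ 2 + t ^ 2 / r * dv t ^ 2 - t * (2 * v t * dv t) := by field_simp; ring
      linarith
    have a3 := mul_le_mul_of_nonneg_right a1 (sq_nonneg (dv t))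
    nlinarith [mul_le_mul_of_nonneg_left (a2.trans (by linarith :
      _ ≤ r * v t ^ 2 + T * (1 - t ^ 2) * dv t ^ 2)) hrt]
  rw [key, intervalIntegral.integral_add, intervalIntegral.integral_const_mul,
    intervalIntegral.integral_const_mul] at step
  rotate_left
  · exact Continuous.intervalIntegrable (by fun_prop) _ _
  · exact Continuous.intervalIntegrable (by fun_prop) _ _
  have b1 := mono (fun t => t ^ (2 * s) * v t ^ 2) (by fun_prop) fun t ht => by
    have := Real.rpow_nonneg ht.1 (2 * s)
    positivity
  have b2 := mono (fun t => (1 - t ^ 2) * t ^ (2 * s) * dv t ^ 2) (by fun_prop) fun t ht => by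
    have := Real.rpow_nonneg ht.1 (2 * s)
    have : 0 ≤ 1 - t ^ 2 := by nlinarith [ht.1, ht.2]
    positivity
  simp only [h.normalized] at b1
  have b3 : T * k ^ 2 ≤ r := by
    rw [hT, div_div, div_mul_eq_mul_div, div_le_iff₀ (by positivity)]
    rw [div_le_iff₀ (by positivity)] at hx'
    have : 9 * (x ^ 2 * k ^ 2) ≤ (1 - x ^ 2) * (25 * k ^ 2) * (x ^ 2 * k ^ 2) :=
      mul_le_mul_of_nonneg_right hx' (by positivity)
    rw [hrdef]
    nlinarith
  have b4 := mul_le_mul_of_nonneg_left ((b2.trans (h.energy_le hs)).trans hlam) hT0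
  have b5 := mul_le_mul_of_nonneg_left b1 (by positivity : 0 ≤ 2 * s + 1 + r)
  have fin : x * (x ^ (2 * s) * v x ^ 2) ≤ 2 * s + 1 + 10 / 3 * k ^ 2 * x := by
    have : r + r = 10 / 3 * k ^ 2 * x := by rw [hrdef]; ring
    simp only [zero_mul, sub_zero] at step
    linarith
  have : (2 * s + 1) / x + 10 / 3 * k ^ 2 = (2 * s + 1 + 10 / 3 * k ^ 2 * x) / x := by
    field_simp
  rw [this, le_div_iff₀ hx]
  linarith

/-- Near `0` the profile itself varies little: integrating the equation from `0`, where the flux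
vanishes, gives `|v' t| ≤ D N t / (1 - X ^ 2)` on `(0, X]`. -/
theorem abs_sub_le_left (hs : 0 < s) (h : IsRegularProfile s c lam v dv) {X N D : ℝ}
    (hX : 0 < X) (hX1 : X < 1) (hN : ∀ x ∈ Icc 0 X, |v x| ≤ N)
    (hD : ∀ t ∈ Icc (0 : ℝ) 1, |lam - c ^ 2 * t ^ 2| ≤ D) {x : ℝ} (hx : x ∈ Icc 0 X) :
    |v X - v x| ≤ D * N * X ^ 2 / (2 * (1 - X ^ 2)) := by
  have hr := continuous_rpow_two_mul hs
  have cv := h.continuous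
  have cd := h.continuous_deriv
  have hN0 : 0 ≤ N := (abs_nonneg _).trans (hN x hx)
  have hD0 : 0 ≤ D := (abs_nonneg _).trans (hD 0 (by simp))
  have hp : 0 < 1 - X ^ 2 := by nlinarith
  have hdv : ∀ t ∈ Ioc 0 X, |dv t| ≤ D * N / (1 - X ^ 2) * t := by
    intro t ht
    have key := integral_eq_sub_of_continuousOn (a := 0) (b := t)
      (f := fun x => (1 - x ^ 2) * x ^ (2 * s) * dv x)
      (f' := fun x => -((lam - c ^ 2 * x ^ 2) * x ^ (2 * s) * v x)) ht.1.le
      (by fun_prop) (by fun_prop) fun y hy => h.ode y ⟨hy.1, hy.2.trans_le (ht.2.trans hX1.le)⟩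
    have b := intervalIntegral.norm_integral_le_of_norm_le_const (a := 0) (b := t)
      (f := fun x => -((lam - c ^ 2 * x ^ 2) * x ^ (2 * s) * v x)) (C := D * t ^ (2 * s) * N) (by
      intro y hy
      have hrt := Real.rpow_nonneg ht.1.le (2 * s)
      rw [uIoc_of_le ht.1.le] at hy
      have hy0 := Real.rpow_nonneg hy.1.le (2 * s)
      rw [norm_neg, norm_mul, norm_mul, Real.norm_eq_abs, Real.norm_eq_abs, Real.norm_eq_abs,
        abs_of_nonneg hy0]
      gcongr
      · exact hD y ⟨hy.1.le, hy.2.trans (ht.2.trans hX1.le)⟩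
      · exact hy.1.le
      · exact hy.2
      · exact hN y ⟨hy.1.le, hy.2.trans ht.2⟩)
    have hrt := Real.rpow_pos_of_pos ht.1 (2 * s)
    have hpt : 1 - X ^ 2 ≤ 1 - t ^ 2 := by nlinarith [ht.1, ht.2]
    have h0 : (0 : ℝ) ^ (2 * s) = 0 := Real.zero_rpow (by linarith)
    rw [key, h0, Real.norm_eq_abs, mul_zero, zero_mul, sub_zero, sub_zero, abs_mul, abs_mul,
      abs_of_pos hrt, abs_of_pos (hp.trans_le hpt), abs_of_pos ht.1] at b
    rw [div_mul_eq_mul_div, le_div_iff₀ hp]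
    have : (1 - t ^ 2) * |dv t| ≤ D * N * t := by
      refine le_of_mul_le_mul_left ?_ hrt
      linarith
    nlinarith [abs_nonneg (dv t)]
  have key := integral_eq_sub_of_continuousOn (a := x) (b := X) hx.2
    cv.continuousOn cd.continuousOn fun y _ => h.hasDerivAt y
  rw [← key, ← Real.norm_eq_abs]
  have := intervalIntegral.norm_integral_le_of_norm_le (μ := volume) (f := dv)
    (g := fun t => D * N / (1 - X ^ 2) * t) hx.2
    (Filter.Eventually.of_forall fun t ht => hdv t ⟨hx.1.trans_lt ht.1, ht.2⟩)
    (Continuous.intervalIntegrable (by fun_prop) _ _)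
  refine this.trans ?_
  rw [intervalIntegral.integral_const_mul, integral_id]
  have e : D * N * X ^ 2 / (2 * (1 - X ^ 2)) = D * N / (1 - X ^ 2) * (X ^ 2 / 2) := by
    field_simp
  rw [e]
  gcongr
  nlinarith [sq_nonneg x]

/-- Near `1` the function `y = x^s v` varies little: it solves
`((1 - x²) y')' = -(lam + s² + s - c² x² - (s² - s) / x²) y`, and integrating this from `1`, where
`(1 - x²) y'` vanishes, bounds `y'`. -/
theorem abs_sub_le_right (h : IsRegularProfile s c lam v dv) {X N K : ℝ}
    (hX : 0 < X) (hX1 : X < 1) (hN : ∀ x ∈ Icc X 1, |x ^ s * v x| ≤ N)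
    (hK : ∀ t ∈ Icc X 1, |lam + s ^ 2 + s - c ^ 2 * t ^ 2 - (s ^ 2 - s) / t ^ 2| ≤ K)
    {x : ℝ} (hx : x ∈ Icc X 1) :
    |x ^ s * v x - X ^ s * v X| ≤ K * N / (1 + X) * (1 - X) := by
  have cv := h.continuous
  have cd := h.continuous_deriv
  have hN0 : 0 ≤ N := (abs_nonneg _).trans (hN x hx)
  have hK0 : 0 ≤ K := (abs_nonneg _).trans (hK x hx)
  have cr : ∀ p : ℝ, ContinuousOn (fun y : ℝ => y ^ p) (Icc X 1) := fun p y hy =>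
    (Real.continuousAt_rpow_const y p (Or.inl (hX.trans_le hy.1).ne')).continuousWithinAt
  have cr2 : ContinuousOn (fun y : ℝ => (y ^ 2)⁻¹) (Icc X 1) :=
    ContinuousOn.inv₀ (by fun_prop) fun y hy => (pow_pos (hX.trans_le hy.1) 2).ne'
  have dφ : ∀ t, 0 < t → HasDerivAt (fun y => y ^ s * v y)
      (t ^ s * dv t + s * t ^ (s - 1) * v t) t := fun t ht => by
    refine ((Real.hasDerivAt_rpow_const (p := s) (Or.inl ht.ne')).mul
      (h.hasDerivAt t)).congr_deriv ?_
    ring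
  have hdφ : ∀ t ∈ Ico X 1, ‖t ^ s * dv t + s * t ^ (s - 1) * v t‖ ≤ K * N / (1 + X) := by
    intro t ht
    have ht0 : 0 < t := hX.trans_le ht.1
    have sub : Icc t 1 ⊆ Icc X 1 := Icc_subset_Icc_left ht.1
    have c1 := (cr (-s)).mono sub
    have c2 := (cr (2 * s)).mono sub
    have c3 := (cr (s - 1)).mono sub
    have c4 := (cr s).mono sub
    have c5 := cr2.mono sub
    have key := integral_eq_sub_of_continuousOn (a := t) (b := 1)
      (f := fun y => y ^ (-s) * ((1 - y ^ 2) * y ^ (2 * s) * dv y) +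
        s * (1 - y ^ 2) * (y ^ (s - 1) * v y))
      (f' := fun y => -((lam + s ^ 2 + s - c ^ 2 * y ^ 2 - (s ^ 2 - s) * (y ^ 2)⁻¹) *
        (y ^ s * v y))) ht.2.le
      (by fun_prop) (by fun_prop) (fun y hy => by
        have hy0 : 0 < y := ht0.trans hy.1
        have h1 := (Real.hasDerivAt_rpow_const (p := -s) (Or.inl hy0.ne')).mul
          (h.ode y ⟨hy0, hy.2⟩)
        have h2 : HasDerivAt (fun y : ℝ => s * (1 - y ^ 2)) (s * (-(2 * y))) y := by
          refine (((hasDerivAt_pow 2 y).const_sub 1).const_mul s).congr_deriv ?_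
          push_cast
          ring
        have h3 := h2.mul ((Real.hasDerivAt_rpow_const (p := s - 1) (Or.inl hy0.ne')).mul
          (h.hasDerivAt y))
        refine (h1.add h3).congr_deriv ?_
        simp only [Pi.mul_apply]
        rw [Real.rpow_sub_one hy0.ne' (s - 1), Real.rpow_sub_one hy0.ne',
          Real.rpow_sub_one hy0.ne', two_mul, Real.rpow_add hy0, Real.rpow_neg hy0.le]
        have := (Real.rpow_pos_of_pos hy0 s).ne'
        field_simp
        ring)
    have b := intervalIntegral.norm_integral_le_of_norm_le_const (a := t) (b := 1)
      (f := fun y => -((lam + s ^ 2 + s - c ^ 2 * y ^ 2 - (s ^ 2 - s) * (y ^ 2)⁻¹) *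
        (y ^ s * v y))) (C := K * N) (by
      intro y hy
      rw [uIoc_of_le ht.2.le] at hy
      have hy' : y ∈ Icc X 1 := ⟨ht.1.trans hy.1.le, hy.2⟩
      rw [norm_neg, norm_mul, Real.norm_eq_abs, Real.norm_eq_abs]
      gcongr
      · simpa only [div_eq_mul_inv] using hK y hy'
      · exact hN y hy')
    have e : t ^ (-s) * ((1 - t ^ 2) * t ^ (2 * s) * dv t) +
        s * (1 - t ^ 2) * (t ^ (s - 1) * v t) =
        (1 - t) * ((1 + t) * (t ^ s * dv t + s * t ^ (s - 1) * v t)) := by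
      rw [two_mul, Real.rpow_add ht0, Real.rpow_neg ht0.le]
      have := (Real.rpow_pos_of_pos ht0 s).ne'
      field_simp
      ring
    have ht1 : 0 < 1 - t := by linarith [ht.2]
    rw [key, e, one_pow, sub_self, mul_zero, zero_mul, zero_mul, zero_mul, mul_zero, zero_add,
      zero_sub, norm_neg, norm_mul, norm_mul, Real.norm_of_nonneg ht1.le,
      Real.norm_of_nonneg (by linarith : 0 ≤ 1 + t), abs_of_pos ht1] at b
    rw [le_div_iff₀ (by linarith)]
    have : (1 + t) * ‖t ^ s * dv t + s * t ^ (s - 1) * v t‖ ≤ K * N :=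
      le_of_mul_le_mul_left (by linarith) ht1
    nlinarith [norm_nonneg (t ^ s * dv t + s * t ^ (s - 1) * v t), ht.1]
  have cf : ContinuousOn (fun y => y ^ s * v y) (Icc X x) := fun y hy =>
    (dφ y (hX.trans_le hy.1)).continuousAt.continuousWithinAt
  have := norm_image_sub_le_of_norm_deriv_right_le_segment (C := K * N / (1 + X)) cf
    (fun y hy => (dφ y (hX.trans_le hy.1)).hasDerivWithinAt)
    (fun y hy => hdφ y ⟨hy.1, hy.2.trans_le hx.2⟩) x ⟨hx.1, le_rfl⟩
  refine this.trans ?_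
  gcongr
  exact hx.2

end IsRegularProfile

/-! ### The finite Hankel transform as a power series -/

theorem contDiff_tsum_mul_pow {d : ℕ → ℝ} (hd : ∀ r : NNReal, Summable fun n => |d n| * r ^ n) :
    ContDiff ℝ 1 fun y : ℝ => ∑' n, d n * y ^ n := by
  have hrad : (FormalMultilinearSeries.ofScalars ℝ d).radius = ⊤ :=
    FormalMultilinearSeries.radius_eq_top_of_summable_norm _ fun r => by
      simpa only [FormalMultilinearSeries.ofScalars_norm, Real.norm_eq_abs] using hd r
  have h := (FormalMultilinearSeries.ofScalars ℝ d).hasFPowerSeriesOnBall (by simp [hrad])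
  have ha := h.analyticOnNhd
  rw [hrad, Metric.eball_top] at ha
  have : ContDiff ℝ 1 _ := contDiffOn_univ.1 (ha.contDiffOn uniqueDiffOn_univ)
  convert this using 1
  ext y
  exact tsum_congr fun n => by
    rw [FormalMultilinearSeries.ofScalars_apply_eq, smul_eq_mul]

/-- The coefficient of `y ^ (2 * k + α)` in the expansion of `besselJ α y`. -/
noncomputable def besselCoeff (α : ℝ) (k : ℕ) : ℝ :=
  (-1 : ℝ) ^ k / ((k.factorial : ℝ) * Real.Gamma ((k : ℝ) + α + 1)) * (1 / 2) ^ (2 * (k : ℝ) + α)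

theorem sqrt_mul_besselJ (α : ℝ) {y : ℝ} (hy : 0 < y) :
    √y * besselJ α y = y ^ (α + 1 / 2) * ∑' k, besselCoeff α k * (y ^ 2) ^ k := by
  rw [besselJ, ← tsum_mul_left, ← tsum_mul_left]
  refine tsum_congr fun k => ?_
  rw [besselCoeff, Real.sqrt_eq_rpow, div_eq_mul_one_div y 2,
    Real.mul_rpow hy.le (by norm_num), Real.rpow_add hy α, Real.rpow_add hy,
    Real.rpow_mul hy.le, Real.rpow_natCast, Real.rpow_two]
  ring

/-- The factor `1 / 2` is needed only for the step from `k = 0` to `k = 1`, where the argument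
`α + 1` of the functional equation may be close to `1 / 2`. -/
theorem Gamma_nat_add_ge {α : ℝ} (hα : -(1 / 2) < α) (k : ℕ) :
    Real.Gamma (α + 1) / 2 ≤ Real.Gamma ((k : ℝ) + α + 1) := by
  have h0 : 0 < Real.Gamma (α + 1) := Real.Gamma_pos_of_pos (by linarith)
  have h1 : ∀ k : ℕ, Real.Gamma (α + 1) / 2 ≤ Real.Gamma (((k + 1 : ℕ) : ℝ) + α + 1) := by
    intro k
    induction k with
    | zero =>
      rw [show ((0 + 1 : ℕ) : ℝ) + α + 1 = (α + 1) + 1 by push_cast; ring,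
        Real.Gamma_add_one (s := α + 1) (by linarith : 0 < α + 1).ne']
      nlinarith
    | succ k ih =>
      have : (1 : ℝ) ≤ ((k + 1 : ℕ) : ℝ) + α + 1 := by
        push_cast
        linarith [(Nat.cast_nonneg k : (0 : ℝ) ≤ k)]
      rw [show ((k + 1 + 1 : ℕ) : ℝ) + α + 1 = (((k + 1 : ℕ) : ℝ) + α + 1) + 1 by push_cast; ring,
        Real.Gamma_add_one (s := ((k + 1 : ℕ) : ℝ) + α + 1) (by linarith)]
      nlinarith
  cases k with
  | zero => simp only [Nat.cast_zero, zero_add]; linarith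
  | succ k => exact h1 k

theorem abs_besselCoeff_le {α : ℝ} (hα : -(1 / 2) < α) :
    ∃ C, 0 ≤ C ∧ ∀ k, |besselCoeff α k| ≤ C / k.factorial := by
  have h0 : 0 < Real.Gamma (α + 1) := Real.Gamma_pos_of_pos (by linarith)
  refine ⟨2 / Real.Gamma (α + 1) * (1 / 2) ^ α, by positivity, fun k => ?_⟩
  have hΓ := Gamma_nat_add_ge hα k
  have hΓ0 : 0 < Real.Gamma ((k : ℝ) + α + 1) := by linarith
  have h2 : ((1 : ℝ) / 2) ^ (2 * (k : ℝ) + α) ≤ (1 / 2) ^ α :=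
    Real.rpow_le_rpow_of_exponent_ge (by norm_num) (by norm_num)
      (by linarith [(Nat.cast_nonneg k : (0 : ℝ) ≤ k)])
  have hp : (0 : ℝ) < (1 / 2) ^ (2 * (k : ℝ) + α) := by positivity
  have hf : (0 : ℝ) < k.factorial := by positivity
  rw [besselCoeff, abs_mul, abs_div, abs_pow, abs_neg, abs_one, one_pow, abs_of_pos hp,
    abs_of_pos (by positivity)]
  calc _ ≤ 1 / ((k.factorial : ℝ) * (Real.Gamma (α + 1) / 2)) * (1 / 2) ^ α := by gcongr
    _ = _ := by field_simp

/-- On `[0,1]`, a finite Hankel transform is `x ^ (α + 1 / 2)` times an entire function of `x ^ 2`: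
integrate the Bessel series term by term. -/
theorem exists_finiteHankel_eq {α c : ℝ} (hα : -(1 / 2) < α) (hc : 0 < c) {φ : ℝ → ℝ}
    (hφ : IntegrableOn φ (Ioc 0 1)) :
    ∃ d : ℕ → ℝ, (∀ r : NNReal, Summable fun n => |d n| * r ^ n) ∧
      ∀ x ∈ Icc (0 : ℝ) 1, finiteHankel α c φ x = x ^ (α + 1 / 2) * ∑' n, d n * (x ^ 2) ^ n := by
  obtain ⟨C, hC, hb⟩ := abs_besselCoeff_le hα
  set e : ℕ → ℝ → ℝ := fun k t =>
    besselCoeff α k * c ^ (α + 1 / 2) * (c ^ 2) ^ k * (t ^ (α + 1 / 2) * (t ^ 2) ^ k * φ t) with he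
  have hs : 0 < α + 1 / 2 := by linarith
  have ht : ∀ k : ℕ, ∀ t ∈ Ioc (0 : ℝ) 1, ‖t ^ (α + 1 / 2) * (t ^ 2) ^ k‖ ≤ 1 := by
    intro k t ht
    have h1 := Real.rpow_le_one ht.1.le ht.2 hs.le
    have h1' := Real.rpow_nonneg ht.1.le (α + 1 / 2)
    have h2 : (t ^ 2) ^ k ≤ 1 := pow_le_one₀ (by positivity) (pow_le_one₀ ht.1.le ht.2)
    rw [Real.norm_of_nonneg (by positivity)]
    exact mul_le_one₀ h1 (by positivity) h2
  have hint : ∀ k, IntegrableOn (fun t => t ^ (α + 1 / 2) * (t ^ 2) ^ k * φ t) (Ioc 0 1) := by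
    intro k
    refine Integrable.bdd_mul (c := 1) hφ ?_ ?_
    · exact Measurable.aestronglyMeasurable (by fun_prop)
    · filter_upwards [ae_restrict_mem measurableSet_Ioc] with t h using ht k t h
  have hei : ∀ k, IntegrableOn (e k) (Ioc 0 1) := fun k => (hint k).const_mul _
  set A := ∫ t in Ioc (0 : ℝ) 1, ‖φ t‖
  have hA : ∀ k, ∫ t in Ioc (0 : ℝ) 1, ‖e k t‖ ≤
      C * c ^ (α + 1 / 2) * A * ((c ^ 2) ^ k / k.factorial) := by
    intro k
    calc _ ≤ ∫ t in Ioc (0 : ℝ) 1, C / k.factorial * c ^ (α + 1 / 2) * (c ^ 2) ^ k * ‖φ t‖ := by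
          refine setIntegral_mono_on (hei k).norm (hφ.norm.const_mul _) measurableSet_Ioc ?_
          intro t h
          have hcs := Real.rpow_nonneg hc.le (α + 1 / 2)
          rw [he]
          simp only [norm_mul (_ * _ * _ : ℝ), norm_mul _ (φ t)]
          rw [norm_mul, norm_mul, Real.norm_of_nonneg hcs,
            Real.norm_of_nonneg (by positivity : 0 ≤ (c ^ 2) ^ k)]
          have := mul_le_mul_of_nonneg_right (ht k t h) (norm_nonneg (φ t))
          rw [one_mul] at this
          gcongr
          exact hb k
      _ = _ := by
          rw [integral_const_mul]
          ring
  have hsum : ∀ r : ℝ, 0 ≤ r → Summable fun k => (∫ t in Ioc (0 : ℝ) 1, ‖e k t‖) * r ^ k := by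
    intro r hr
    refine Summable.of_nonneg_of_le (fun k => by positivity) (fun k => ?_)
      ((Real.summable_pow_div_factorial (c ^ 2 * r)).mul_left (C * c ^ (α + 1 / 2) * A))
    calc _ ≤ C * c ^ (α + 1 / 2) * A * ((c ^ 2) ^ k / k.factorial) * r ^ k := by
          gcongr
          exact hA k
      _ = _ := by rw [mul_pow]; ring
  refine ⟨fun k => ∫ t in Ioc (0 : ℝ) 1, e k t, fun r => ?_, fun x hx => ?_⟩
  · refine Summable.of_nonneg_of_le (fun k => by positivity) (fun k => ?_) (hsum r r.2)
    gcongr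
    exact norm_integral_le_integral_norm (e k)
  rcases hx.1.eq_or_lt with rfl | hx0
  · rw [Real.zero_rpow hs.ne']
    simp [finiteHankel]
  have key := hasSum_integral_of_summable_integral_norm (μ := volume.restrict (Ioc (0 : ℝ) 1))
    (F := fun k t => e k t * (x ^ 2) ^ k) (fun k => (hei k).mul_const _) (by
      simp only [norm_mul, integral_mul_const]
      simpa using hsum (x ^ 2) (sq_nonneg x))
  simp only [integral_mul_const] at key
  rw [key.tsum_eq, finiteHankel, intervalIntegral.integral_of_le zero_le_one,
    ← integral_const_mul]
  refine setIntegral_congr_fun measurableSet_Ioc fun t h => ?_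
  rw [sqrt_mul_besselJ α (mul_pos (mul_pos hc h.1) hx0), mul_assoc, ← tsum_mul_right,
    ← tsum_mul_left, ← tsum_mul_left]
  refine tsum_congr fun k => ?_
  rw [he]
  simp only
  rw [Real.mul_rpow (mul_pos hc h.1).le hx0.le, Real.mul_rpow hc.le h.1.le]
  ring

/-- Being in the range of the finite Hankel transform makes `x ^ (-(α + 1 / 2)) * φ x` regular at both
end points; the equation for it is the one for `φ` rewritten. -/
theorem IsCPSWF.exists_isRegularProfile {α c χ : ℝ} {φ : ℝ → ℝ} (hα : -(1 / 2) < α) (hc : 0 < c)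
    (h : IsCPSWF α c χ φ) : ∃ v dv : ℝ → ℝ,
      IsRegularProfile (α + 1 / 2) c (χ - (α + 1 / 2) ^ 2 - (α + 1 / 2)) v dv ∧
      ∀ x ∈ Icc (0 : ℝ) 1, φ x = x ^ (α + 1 / 2) * v x := by
  set s := α + 1 / 2 with hs
  have hs0 : 0 < s := by linarith
  have hint : IntegrableOn φ (Ioc 0 1) := by
    rw [integrableOn_Ioc_iff_integrableOn_Ioo]
    exact h.memLp.integrable one_le_two
  obtain ⟨μ, hμ, hH⟩ := h.hankel_eigen
  obtain ⟨d, hd, hdH⟩ := exists_finiteHankel_eq hα hc hint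
  set v : ℝ → ℝ := fun x => μ⁻¹ * ∑' n, d n * (x ^ 2) ^ n with hv
  have hvC : ContDiff ℝ 1 v :=
    contDiff_const.mul ((contDiff_tsum_mul_pow hd).comp (contDiff_id.pow 2))
  have hφ : ∀ x ∈ Icc (0 : ℝ) 1, φ x = x ^ s * v x := by
    intro x hx
    have := hH x hx
    rw [hdH x hx] at this
    rw [hv]
    simp only
    field_simp
    linarith
  clear_value s v
  have hvd : ∀ x, HasDerivAt v (deriv v x) x := fun x =>
    (hvC.differentiable one_ne_zero x).hasDerivAt
  refine ⟨v, deriv v, ⟨hvd, hvC.continuous_deriv le_rfl, ?_, ?_⟩, hφ⟩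
  · intro x hx
    have h2 := (contDiffOn_succ_iff_deriv_of_isOpen (n := 1) isOpen_Ioo).1
      (by simpa [one_add_one_eq_two] using h.contDiffOn)
    have hφd : ∀ y ∈ Ioo (0 : ℝ) 1, HasDerivAt φ (deriv φ y) y := fun y hy =>
      (h2.1.differentiableAt (isOpen_Ioo.mem_nhds hy)).hasDerivAt
    have hφ2 : DifferentiableAt ℝ (deriv φ) x :=
      (h2.2.2.differentiableOn one_ne_zero).differentiableAt (isOpen_Ioo.mem_nhds hx)
    have hdv : ∀ y ∈ Ioo (0 : ℝ) 1, deriv φ y = y ^ s * deriv v y + s * y ^ (s - 1) * v y := by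
      intro y hy
      have e : HasDerivAt (fun y => y ^ s * v y) (deriv φ y) y :=
        (hφd y hy).congr_of_eventuallyEq (by
          filter_upwards [isOpen_Ioo.mem_nhds hy] with t ht
          exact (hφ t ⟨ht.1.le, ht.2.le⟩).symm)
      rw [e.unique ((Real.hasDerivAt_rpow_const (p := s) (Or.inl hy.1.ne')).mul (hvd y))]
      ring
    have hq : DifferentiableAt ℝ (fun y => (1 - y ^ 2) * deriv φ y) x :=
      DifferentiableAt.mul (by fun_prop) hφ2
    have ode := h.diff_eigen x hx
    rw [hankelDiffOp] at ode
    set L := deriv (fun y => (1 - y ^ 2) * deriv φ y) x with hL'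
    have hp : HasDerivAt (fun y : ℝ => s * (1 - y ^ 2)) (s * (-(2 * x))) x := by
      refine (((hasDerivAt_pow 2 x).const_sub 1).const_mul s).congr_deriv ?_
      push_cast
      ring
    have D := ((Real.hasDerivAt_rpow_const (p := s) (Or.inl hx.1.ne')).mul hq.hasDerivAt).sub
      (hp.mul ((Real.hasDerivAt_rpow_const (p := s - 1) (Or.inl hx.1.ne')).mul (hφd x hx)))
    have D' := D.congr_of_eventuallyEq (f₁ := fun y => (1 - y ^ 2) * y ^ (2 * s) * deriv v y) (by
      filter_upwards [isOpen_Ioo.mem_nhds hx] with y hy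
      simp only [Pi.sub_apply, Pi.mul_apply]
      rw [hdv y hy, hφ y ⟨hy.1.le, hy.2.le⟩, Real.rpow_sub_one hy.1.ne', two_mul,
        Real.rpow_add hy.1]
      ring)
    refine D'.congr_deriv ?_
    have hL : L = -(χ * φ x) - ((1 / 4 - α ^ 2) / x ^ 2 - c ^ 2 * x ^ 2) * φ x := by linarith
    have hx0 := hx.1.ne'
    have hsα : α = s - 1 / 2 := by rw [hs]; ring
    simp only [Pi.mul_apply]
    rw [← hL', hL, hφ x ⟨hx.1.le, hx.2.le⟩, Real.rpow_sub_one hx0 (s - 1),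
      Real.rpow_sub_one hx0, two_mul s, Real.rpow_add hx.1, hsα]
    field_simp
    ring
  · refine Eq.trans ?_ h.normalized
    refine intervalIntegral.integral_congr fun x hx => ?_
    rw [uIcc_of_le zero_le_one] at hx
    rw [hφ x hx, mul_pow (x ^ s), ← Real.rpow_mul_natCast hx.1, mul_comm s]
    norm_num

/-! ### Bounds for the coefficients of the equations -/

theorem abs_sub_sq_mul_sq_le {s c χ t : ℝ} (hs : 0 < s) (hc : c ^ 2 + s ^ 2 - s ≤ χ)
    (hχ : 3 / 2 ≤ χ) (hχs : s ^ 2 + s ≤ χ) (ht : t ∈ Icc (0 : ℝ) 1) :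
    |χ - s ^ 2 - s - c ^ 2 * t ^ 2| ≤ 4 / 3 * χ := by
  have t3 : c ^ 2 * t ^ 2 ≤ c ^ 2 :=
    mul_le_of_le_one_right (sq_nonneg c) (pow_le_one₀ ht.1 ht.2)
  have t4 : 0 ≤ c ^ 2 * t ^ 2 := by positivity
  rw [abs_le]
  refine ⟨?_, by nlinarith⟩
  rcases le_total s 1 with h1 | h1
  · linarith
  · have : s ≤ s ^ 2 := by nlinarith
    linarith

theorem abs_potential_le {s c χ t : ℝ} (hs : 0 < s) (hc : c ^ 2 + s ^ 2 - s ≤ χ)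
    (hχ : 3 / 2 ≤ χ) (hχs : s ^ 2 + s ≤ χ) (ht0 : 3 / 4 ≤ t ^ 2) (ht1 : t ^ 2 ≤ 1) :
    |χ - c ^ 2 * t ^ 2 - (s ^ 2 - s) / t ^ 2| ≤ 4 / 3 * χ := by
  have t3 : c ^ 2 * t ^ 2 ≤ c ^ 2 := mul_le_of_le_one_right (sq_nonneg c) ht1
  have t4 : 0 ≤ c ^ 2 * t ^ 2 := by positivity
  have t5 : 1 ≤ (t ^ 2)⁻¹ := (one_le_inv₀ (by linarith)).2 ht1
  have t6 : (t ^ 2)⁻¹ ≤ 4 / 3 := by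
    rw [inv_le_comm₀ (by linarith) (by norm_num)]
    linarith
  rw [div_eq_mul_inv, abs_le]
  set q := (t ^ 2)⁻¹
  rcases le_total s 1 with h1 | h1
  · have s1 : 0 ≤ s - s ^ 2 := by nlinarith
    have s2 : s - s ^ 2 ≤ 1 / 4 := by nlinarith [sq_nonneg (2 * s - 1)]
    have s3 : (s - s ^ 2) * 1 ≤ (s - s ^ 2) * q := mul_le_mul_of_nonneg_left t5 s1
    have s4 : (s - s ^ 2) * q ≤ (s - s ^ 2) * (4 / 3) := mul_le_mul_of_nonneg_left t6 s1
    constructor <;> linarith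
  · have s1 : 0 ≤ s ^ 2 - s := by nlinarith
    have s3 : (s ^ 2 - s) * 1 ≤ (s ^ 2 - s) * q := mul_le_mul_of_nonneg_left t5 s1
    have s4 : (s ^ 2 - s) * q ≤ (s ^ 2 - s) * (4 / 3) := mul_le_mul_of_nonneg_left t6 s1
    constructor <;> linarith

/-! ### The sup-norm bound for a profile -/

namespace IsRegularProfile

variable {s c lam : ℝ} {v dv : ℝ → ℝ}

/-- The bound on the middle of the interval. The end points `1 / (2 k)` and `1 - 1 / (5 k ^ 2)`, with
`k ^ 2` the eigenvalue, are the scales on which `v` and `x ^ s * v` vary little near `0` and `1`. -/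
theorem sq_le_of_mem_middle (hs : 0 < s) (h : IsRegularProfile s c lam v dv) {k y : ℝ}
    (hk : 0 < k) (hlam : lam ≤ k ^ 2) (hχ : 3 / 2 ≤ k ^ 2) (hsk : s ^ 2 + s ≤ k ^ 2)
    (hy₁ : 1 / (2 * k) ≤ y) (hy₂ : y ≤ 1 - 1 / (5 * k ^ 2)) :
    (y ^ s * v y) ^ 2 ≤ 25 / 3 * k ^ 2 := by
  have hy0 : 0 < y := lt_of_lt_of_le (by positivity) hy₁
  have hs1 : 2 * s + 1 ≤ 5 / 2 * k := by
    refine le_of_sq_le_sq ?_ (by positivity)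
    rcases le_total s 1 with h1 | h1 <;> nlinarith
  have hp : 9 / (25 * k ^ 2) ≤ 1 - y ^ 2 := by
    have e : 9 / (25 * k ^ 2) = 9 / 5 * (1 / (5 * k ^ 2)) := by
      field_simp
      norm_num
    have hε : 1 / (5 * k ^ 2) ≤ 2 / 15 := by
      rw [div_le_div_iff₀ (by positivity) (by norm_num)]
      linarith
    rw [e]
    have hε0 : 0 < 1 / (5 * k ^ 2) := by positivity
    set ε := 1 / (5 * k ^ 2)
    have := pow_le_pow_left₀ hy0.le hy₂ 2
    nlinarith
  have := h.rpow_mul_sq_le_interior hs hk hlam hy0 hp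
  have b : (2 * s + 1) / y ≤ 5 * k ^ 2 := by
    rw [div_le_iff₀ (by positivity)] at hy₁
    rw [div_le_iff₀ hy0]
    nlinarith [mul_le_mul_of_nonneg_left hy₁ hk.le]
  rw [mul_pow, ← Real.rpow_mul_natCast hy0.le, mul_comm s]
  push_cast
  linarith

/-- If the maximum `M` of `|x ^ s * v x|` is not attained in the middle, then it is attained near an
end point, and exceeds the value at the nearest point of the middle by at most `M / 5`. So
`(4 / 5 * M) ^ 2 ≤ 25 / 3 * χ` in all cases, and `(5 / 4) ^ 2 * (25 / 3) = 625 / 48 < 27 / 2`. -/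
theorem sq_le_mul_eigenvalue (hs : 0 < s) (h : IsRegularProfile s c lam v dv) {χ : ℝ}
    (hlam : lam = χ - s ^ 2 - s) (hc : c ^ 2 + s ^ 2 - s ≤ χ) (hχ : 3 / 2 ≤ χ)
    {x : ℝ} (hx : x ∈ Icc (0 : ℝ) 1) : (x ^ s * v x) ^ 2 ≤ 27 / 2 * χ := by
  have hχs : s ^ 2 + s ≤ χ := by linarith [h.eigenvalue_nonneg hs]
  obtain ⟨k, hk, rfl⟩ : ∃ k : ℝ, 0 < k ∧ χ = k ^ 2 :=
    ⟨√χ, Real.sqrt_pos.2 (by linarith), (Real.sq_sqrt (by linarith)).symm⟩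
  have cφ : Continuous fun y => |y ^ s * v y| :=
    ((Real.continuous_rpow_const hs.le).mul h.continuous).abs
  obtain ⟨x₀, hx₀, hmax⟩ := isCompact_Icc.exists_isMaxOn
    (nonempty_Icc.2 (zero_le_one (α := ℝ))) cφ.continuousOn
  replace hmax : ∀ y ∈ Icc (0 : ℝ) 1, |y ^ s * v y| ≤ |x₀ ^ s * v x₀| := fun y hy => hmax hy
  set M := |x₀ ^ s * v x₀| with hM
  have hM0 : 0 ≤ M := abs_nonneg _
  set X₁ := 1 / (2 * k) with hX₁
  set ε := 1 / (5 * k ^ 2) with hε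
  have hX₁0 : 0 < X₁ := by positivity
  have hε0 : 0 < ε := by positivity
  have hX₁k : X₁ * k = 1 / 2 := by rw [hX₁]; field_simp
  have hεk : ε * k ^ 2 = 1 / 5 := by rw [hε]; field_simp
  have hX₁2 : X₁ ^ 2 * k ^ 2 = 1 / 4 := by rw [← mul_pow, hX₁k]; norm_num
  have hX₁2' : X₁ ^ 2 ≤ 1 / 6 := by nlinarith [sq_nonneg X₁]
  have hε' : ε ≤ 2 / 15 := by nlinarith
  have hX₁1 : X₁ < 1 / 2 := by nlinarith
  have mid : ∀ y, X₁ ≤ y → y ≤ 1 - ε → (y ^ s * v y) ^ 2 ≤ 25 / 3 * k ^ 2 := fun y hy₁ hy₂ =>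
    h.sq_le_of_mem_middle hs hk (by nlinarith) hχ hχs hy₁ hy₂
  suffices ∃ y, X₁ ≤ y ∧ y ≤ 1 - ε ∧ M ≤ |y ^ s * v y| + M / 5 by
    obtain ⟨y, hy1, hy2, hy⟩ := this
    have a := mid y hy1 hy2
    have b := hmax x hx
    rw [← sq_abs] at a ⊢
    have b' : |x ^ s * v x| ^ 2 ≤ M ^ 2 := by gcongr
    have : (4 / 5 * M) ^ 2 ≤ |y ^ s * v y| ^ 2 := by
      gcongr
      linarith
    nlinarith
  rcases le_or_gt x₀ (1 - ε) with hr | hr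
  · rcases le_or_gt X₁ x₀ with hl | hl
    · exact ⟨x₀, hl, hr, by linarith⟩
    -- Near `0` compare the values of `v`, and then use that `x ^ s` is increasing.
    · refine ⟨X₁, le_rfl, by linarith, ?_⟩
      obtain ⟨x₁, hx₁, hmax'⟩ := isCompact_Icc.exists_isMaxOn
        (nonempty_Icc.2 hX₁0.le) h.continuous.abs.continuousOn
      replace hmax' : ∀ y ∈ Icc 0 X₁, |v y| ≤ |v x₁| := fun y hy => hmax' hy
      have a := h.abs_sub_le_left hs hX₁0 (by linarith) hmax' (D := 4 / 3 * k ^ 2)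
        (fun t ht => by rw [hlam]; exact abs_sub_sq_mul_sq_le hs hc hχ hχs ht) hx₁
      have hb : 4 / 3 * k ^ 2 * |v x₁| * X₁ ^ 2 / (2 * (1 - X₁ ^ 2)) ≤ |v x₁| / 5 := by
        rw [div_le_iff₀ (by linarith)]
        have : 4 / 3 * k ^ 2 * |v x₁| * X₁ ^ 2 = 1 / 3 * |v x₁| := by
          linear_combination (4 / 3 * |v x₁|) * hX₁2
        rw [this]
        nlinarith [abs_nonneg (v x₁)]
      have tri := abs_sub_abs_le_abs_sub (v x₁) (v X₁)
      rw [abs_sub_comm] at tri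
      have hv : |v x₀| ≤ 5 / 4 * |v X₁| :=
        (hmax' x₀ ⟨hx₀.1, hl.le⟩).trans (by linarith)
      have hp : x₀ ^ s ≤ X₁ ^ s := Real.rpow_le_rpow hx₀.1 hl.le hs.le
      have hp0 : 0 ≤ x₀ ^ s := Real.rpow_nonneg hx₀.1 s
      have : M ≤ 5 / 4 * |X₁ ^ s * v X₁| := by
        rw [hM, abs_mul, abs_mul, abs_of_nonneg hp0, abs_of_nonneg (hp0.trans hp)]
        calc _ ≤ X₁ ^ s * (5 / 4 * |v X₁|) := by gcongr
          _ = _ := by ring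
      linarith
  · refine ⟨1 - ε, by linarith, le_rfl, ?_⟩
    have a := h.abs_sub_le_right (X := 1 - ε) (N := M) (K := 4 / 3 * k ^ 2) (by linarith)
      (by linarith) (fun y hy => hmax y ⟨by linarith [hy.1], hy.2⟩) (fun t ht => by
        rw [show lam + s ^ 2 + s = k ^ 2 by linarith]
        exact abs_potential_le hs hc hχ hχs (by nlinarith [ht.1])
          (pow_le_one₀ (by linarith [ht.1]) ht.2)) ⟨hr.le, hx₀.2⟩
    have hb : 4 / 3 * k ^ 2 * M / (1 + (1 - ε)) * (1 - (1 - ε)) ≤ M / 5 := by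
      rw [div_mul_eq_mul_div, div_le_iff₀ (by linarith)]
      have : 4 / 3 * k ^ 2 * M * (1 - (1 - ε)) = 4 / 15 * M := by
        linear_combination (4 / 3 * M) * hεk
      rw [this]
      nlinarith
    have tri := abs_sub_abs_le_abs_sub (x₀ ^ s * v x₀) ((1 - ε) ^ s * v (1 - ε))
    linarith

end IsRegularProfile

/-! ### The bound for circular prolate spheroidal wave functions -/

theorem mainTheorem5 (α c : ℝ) (hα : -(1 / 2) < α) (hc : 0 < c)
    (hcα : α ^ 2 - 1 / 4 < c ^ 2)
    (n : ℕ) (hn : 0 < n) (χ : ℝ) (φ : ℝ → ℝ) (hφ : IsNthCPSWF α c n χ φ)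
    (hχ : c ^ 2 + α ^ 2 - 1 / 4 ≤ χ)
    (hb : Real.sqrt χ / (1 - bAlpha α χ) * bAlpha α χ ^ (3 / 2 : ℝ) ≤ 3 * Real.sqrt (3 / 2)) :
    ∀ x ∈ Set.Icc (0 : ℝ) 1, |φ x| ≤ 3 * Real.sqrt (3 / 2) * χ ^ (1 / 2 : ℝ) := by
  intro x hx
  have hs : 0 < α + 1 / 2 := by linarith
  obtain ⟨v, dv, hv, hφv⟩ := hφ.isCPSWF.exists_isRegularProfile hα hc
  have hχ' : 3 / 2 ≤ χ := by
    -- For `1 / 2 ≤ α` this holds for every eigenvalue; for `α < 1 / 2` it can fail for the lowest one,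
    -- and this is the place where `0 < n` matters.
    rcases lt_or_ge (α + 1 / 2) 1 with h1 | h1
    · have hne : {χ' | χ' ∈ chiSpectrum α c ∧ χ' < χ}.Nonempty := by
        rw [← Set.encard_ne_zero, hφ.rank]
        exact_mod_cast hn.ne'
      obtain ⟨χ', ⟨ψ, hψ⟩, hlt⟩ := hne
      obtain ⟨u, du, hu, -⟩ := hψ.exists_isRegularProfile hα hc
      linarith [hv.three_halves_le_of_lt hs h1 hu (by linarith)]
    · nlinarith [hv.eigenvalue_nonneg hs]
  have key := hv.sq_le_mul_eigenvalue hs rfl (by linarith) hχ' hx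
  rw [hφv x hx, ← Real.sqrt_eq_rpow]
  refine abs_le_of_sq_le_sq ?_ (by positivity)
  rw [mul_pow (3 * √(3 / 2)), mul_pow 3, Real.sq_sqrt (by norm_num), Real.sq_sqrt (by linarith)]
  linarith
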